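/- Let $q$ be an indeterminate and write $(z)_k=\prod_{i=0}^{k-1}(1-zq^i)$. Let $x=(x_1,\dots,x_n)$, let $a=(a_1,\dots,a_n)$ be a sequence of nonnegative integers, and put $|a|=a_1+\cdots+a_n$, $\sigma_k=a_1+\cdots+a_k$ and $\binom{|a|}{a}_q=\frac{(q)_{|a|}}{(q)_{a_1}\cdots(q)_{a_n}}$. Let $x^{(a)}$ be the alphabet consisting of the $|a|$ letters $x_iq^j$ with $1\le i\le n$ and $0\le j<a_i$, let $h_m$ be the $m$th complete symmetric function, and let $\mathrm{CT}[f]\in\mathbb{Q}(q)$ denote the constant term of a Laurent polynomial $f$ in $x_1,\dots,x_n$ over $\mathbb{Q}(q)$. For a sequence $v=(v_1,\dots,v_n)$ of nonnegative integers, write $x^{-v}=x_1^{-v_1}\cdots x_n^{-v_n}$, let $v^+$ be the partition obtained by sorting the entries of $v$ into weakly decreasing order (zeros omitted), and define \[ D_{v,(m)}(a)=\mathrm{CT}\bigg[x^{-v}\,h_m\big(x^{(a)}\big)\prod_{1\le i<j\le n}(x_i/x_j)_{a_i}(qx_j/x_i)_{a_j}\bigg]. \] Then for every positive integer $m$, all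 such $v$ and all such $a$, \[ D_{v,(m)}(a)=0\quad\text{if } v^+\neq(m), \] and \[ D_{v,(m)}(a)=\frac{q^{\sigma_n-\sigma_k}(1-q^{a_k})(q^{|a|})_m}{(1-q^{|a|})(q^{|a|-a_k+1})_m}\binom{|a|}{a}_q \quad\text{if } v=(\underbrace{0,\dots,0}_{k-1},m,\underbrace{0,\dots,0}_{n-k}), \] where for $|a|=0$ the right-hand side is read as $0$. -/

import Mathlib

namespace Kadell

/-- The coefficient field `ℚ(q)` of rational functions in one indeterminate. -/
abbrev K : Type := RatFunc ℚ

/-- The indeterminate `q`. -/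
noncomputable def q : K := RatFunc.X

/-- Laurent polynomials in `x_1, …, x_n` over `ℚ(q)`: the exponent vectors are integer sequences
of length `n`. -/
abbrev Laurent (n : ℕ) : Type := AddMonoidAlgebra K (Fin n → ℤ)

/-- The monomial `x^u = x_1^{u_1} ⋯ x_n^{u_n}`. -/
noncomputable def mono {n : ℕ} (u : Fin n → ℤ) : Laurent n := AddMonoidAlgebra.single u 1

/-- The variable `x_i`. -/
noncomputable def x {n : ℕ} (i : Fin n) : Laurent n := mono (Pi.single i 1)

/-- The ratio `x_i / x_j`. -/
noncomputable def ratio {n : ℕ} (i j : Fin n) : Laurent n :=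
  mono (Pi.single i 1 - Pi.single j 1)

/-- The constant term `CT[f]`: the coefficient of `x^0`. -/
noncomputable def CT {n : ℕ} (f : Laurent n) : K := f.coeff 0

/-- The element `q`, regarded as a constant Laurent polynomial. -/
noncomputable def qL (n : ℕ) : Laurent n := algebraMap K (Laurent n) q

/-- The shifted factorial `(z)_k = ∏_{i=0}^{k-1} (1 - z p^i)` with base `p`. -/
def qPoch {R : Type*} [CommRing R] (p z : R) (k : ℕ) : R :=
  ∏ i ∈ Finset.range k, (1 - z * p ^ i)

/-- `|a| = a_1 + ⋯ + a_n`. -/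
def total {n : ℕ} (a : Fin n → ℕ) : ℕ := ∑ i, a i

/-- The partial sum `σ_k = a_1 + ⋯ + a_k`. -/
def partialSum {n : ℕ} (a : Fin n → ℕ) (k : Fin n) : ℕ := ∑ i ∈ Finset.Iic k, a i

/-- The `q`-multinomial coefficient `(q)_{|a|} / ((q)_{a_1} ⋯ (q)_{a_n})`. -/
noncomputable def qMultinomial {n : ℕ} (a : Fin n → ℕ) : K :=
  qPoch q q (total a) / ∏ i, qPoch q q (a i)

/-- The alphabet `x^{(a)}`, consisting of the letters `x_i q^j` with `0 ≤ j < a_i`. -/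
noncomputable def alphabet {n : ℕ} (a : Fin n → ℕ) (s : Σ i : Fin n, Fin (a i)) : Laurent n :=
  x s.1 * qL n ^ (s.2 : ℕ)

/-- `h_m(x^{(a)})`: the complete symmetric function of degree `m` in the letters of `x^{(a)}`. -/
noncomputable def hAlphabet {n : ℕ} (a : Fin n → ℕ) (m : ℕ) : Laurent n :=
  MvPolynomial.aeval (alphabet a) (MvPolynomial.hsymm (Σ i : Fin n, Fin (a i)) K m)

/-- The `q`-Dyson product `∏_{i<j} (x_i/x_j)_{a_i} (q x_j/x_i)_{a_j}`. -/
noncomputable def dyson {n : ℕ} (a : Fin n → ℕ) : Laurent n :=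
  ∏ i, ∏ j ∈ Finset.Ioi i,
    qPoch (qL n) (ratio i j) (a i) * qPoch (qL n) (qL n * ratio j i) (a j)

/-- `D_{v,(m)}(a) = CT[x^{-v} h_m(x^{(a)}) ∏_{i<j} (x_i/x_j)_{a_i} (q x_j/x_i)_{a_j}]`. -/
noncomputable def D {n : ℕ} (v : Fin n → ℕ) (m : ℕ) (a : Fin n → ℕ) : K :=
  CT (mono (fun i => -(v i : ℤ)) * hAlphabet a m * dyson a)

/-- The partition `v^+` obtained by sorting the composition `v` into weakly decreasing order,
written without its tail of zeros. -/
def sortedParts {n : ℕ} (v : Fin n → ℕ) : List ℕ :=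
  ((Finset.univ.val.map v).filter (fun p => p ≠ 0)).sort (fun b c => c ≤ b)

end Kadell

/-!
The coefficient in question is one of top degree, so `h_m(X)`, `X = x^{(a)}`, may be replaced by
`h_m(X - Y)` for any alphabet `Y` of constants; take `Y` to consist of the first `|a| + m - 1`
powers of `q`. By the combinatorial Nullstellensatz, a top coefficient is determined by the values
on a grid of powers of `q`. Where the `q`-Dyson product does not vanish at such a point, the letters
are distinct powers of `q`, and `h_m(X - Y)` becomes a product that is zero as soon as all letters
belong to `Y`. If `v ≠ m e_k` this happens on the whole grid. If `v = m e_k` only the hyperplane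
`x_k = q^{|a| - a_k + m}` is left, on which the values are those of the `q`-Dyson product in the
other variables times univariate polynomials with known leading coefficients. The constant that
remains is given by the `q`-Dyson theorem, which the same interpolation proves by induction on the
number of variables.
-/

namespace Kadell

open Finset
open MvPolynomial (C X)

section Interpolation

variable {ι F : Type*} [Field F] {p : F}

theorem coeff_eq_of_eval_eq_on_grid [Finite ι] (hp : Function.Injective fun j : ℕ => p ^ j)
    {P Q : MvPolynomial ι F} {d : ι →₀ ℕ} (hP : P.totalDegree ≤ d.degree)
    (hQ : Q.totalDegree ≤ d.degree)
    (h : ∀ α : ι → ℕ, (∀ i, α i ≤ d i) →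
      MvPolynomial.eval (fun i => p ^ α i) P = MvPolynomial.eval (fun i => p ^ α i) Q) :
    P.coeff d = Q.coeff d := by
  classical
  by_contra hne
  have hcoeff : (P - Q).coeff d ≠ 0 := by rwa [MvPolynomial.coeff_sub, sub_ne_zero]
  have hdegree : (P - Q).totalDegree = d.degree :=
    ((MvPolynomial.totalDegree_sub P Q).trans (max_le hP hQ)).antisymm
      (MvPolynomial.le_totalDegree (MvPolynomial.mem_support_iff.mpr hcoeff))
  obtain ⟨y, hy, hy0⟩ := MvPolynomial.combinatorial_nullstellensatz_exists_eval_nonzero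
    (P - Q) d hcoeff hdegree (fun i => (range (d i + 1)).image fun j => p ^ j)
    fun i => by simp [card_image_of_injective _ hp]
  have hgrid : ∀ i, ∃ j ≤ d i, p ^ j = y i := by simpa [Nat.lt_succ_iff] using hy
  choose α hα hαy using hgrid
  obtain rfl : (fun i => p ^ α i) = y := funext hαy
  exact hy0 (by rw [map_sub, h α hα, sub_self])

variable {R : Type*} [CommRing R]

theorem coeff_mul_aeval_X {H : MvPolynomial ι R} {d : ι →₀ ℕ} (hH : H.totalDegree ≤ d.degree)
    (i : ι) {P : Polynomial R} {e : ℕ} (hP : P.natDegree ≤ e) :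
    (H * Polynomial.aeval (X i) P).coeff (d + Finsupp.single i e) =
      P.coeff e * H.coeff d := by
  classical
  have hterm : ∀ r ∈ range (e + 1), (P.coeff r • (H * X i ^ r)).coeff (d + Finsupp.single i e) =
      if r = e then P.coeff e * H.coeff d else 0 := by
    intro r hr
    have hre : r ≤ e := Nat.lt_succ_iff.mp (mem_range.mp hr)
    have hshift : d + Finsupp.single i e = d + Finsupp.single i (e - r) + Finsupp.single i r := by
      rw [add_assoc, ← Finsupp.single_add, Nat.sub_add_cancel hre]
    rw [MvPolynomial.coeff_smul, MvPolynomial.X_pow_eq_monomial, hshift,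
      MvPolynomial.coeff_mul_monomial, mul_one, smul_eq_mul]
    split_ifs with h
    · subst h
      simp
    · rw [MvPolynomial.coeff_eq_zero_of_totalDegree_lt, mul_zero]
      refine hH.trans_lt ?_
      change d.degree < (d + Finsupp.single i (e - r)).degree
      rw [map_add, Finsupp.degree_single]
      omega
  rw [Polynomial.aeval_eq_sum_range' (Nat.lt_succ_of_le hP), mul_sum, MvPolynomial.coeff_sum]
  simp_rw [mul_smul_comm]
  rw [sum_congr rfl hterm]
  simp

theorem totalDegree_aeval_X_le (i : ι) (P : Polynomial R) :
    (Polynomial.aeval (X i : MvPolynomial ι R) P).totalDegree ≤ P.natDegree := by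
  rw [Polynomial.aeval_eq_sum_range]
  refine MvPolynomial.totalDegree_finsetSum_le fun r hr => ?_
  refine (MvPolynomial.totalDegree_smul_le _ _).trans ?_
  rw [MvPolynomial.X_pow_eq_monomial]
  refine (MvPolynomial.totalDegree_monomial_le _ _).trans ?_
  simpa using Nat.lt_succ_iff.mp (mem_range.mp hr)

variable {s : Finset ι} {P : ι → Polynomial R} {e : ι → ℕ}

theorem totalDegree_mul_prod_aeval_X_le {H : MvPolynomial ι R} {h : ℕ} (hH : H.totalDegree ≤ h)
    (hP : ∀ i ∈ s, (P i).natDegree ≤ e i) :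
    (H * ∏ i ∈ s, Polynomial.aeval (X i) (P i)).totalDegree ≤ h + ∑ i ∈ s, e i := by
  refine (MvPolynomial.totalDegree_mul _ _).trans (add_le_add hH ?_)
  refine (MvPolynomial.totalDegree_finsetProd _ _).trans ?_
  exact sum_le_sum fun i hi => (totalDegree_aeval_X_le i (P i)).trans (hP i hi)

theorem coeff_mul_prod_aeval_X {H : MvPolynomial ι R} {d : ι →₀ ℕ}
    (hH : H.totalDegree ≤ d.degree) (hP : ∀ i ∈ s, (P i).natDegree ≤ e i) :
    (H * ∏ i ∈ s, Polynomial.aeval (X i) (P i)).coeff (d + ∑ i ∈ s, Finsupp.single i (e i)) =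
      (∏ i ∈ s, (P i).coeff (e i)) * H.coeff d := by
  classical
  induction s using Finset.induction_on with
  | empty => simp
  | insert k s hk ih =>
    have hPs : ∀ i ∈ s, (P i).natDegree ≤ e i := fun i hi => hP i (mem_insert_of_mem hi)
    have hdegree : (H * ∏ i ∈ s, Polynomial.aeval (X i) (P i)).totalDegree ≤
        (d + ∑ i ∈ s, Finsupp.single i (e i)).degree :=
      (totalDegree_mul_prod_aeval_X_le hH hPs).trans (by simp)
    rw [prod_insert hk, prod_insert hk, sum_insert hk, add_left_comm, add_comm (Finsupp.single k _),
      mul_left_comm, mul_comm (Polynomial.aeval _ _),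
      coeff_mul_aeval_X hdegree k (hP k (mem_insert_self k s)), ih hPs, mul_assoc]

theorem eval_aeval_X (y : ι → R) (i : ι) (P : Polynomial R) :
    MvPolynomial.eval y (Polynomial.aeval (X i) P) = P.eval (y i) := by
  rw [← MvPolynomial.coe_aeval_eq_eval, RingHom.coe_coe, ← Polynomial.aeval_algHom_apply,
    MvPolynomial.aeval_X, Polynomial.coe_aeval_eq_eval]

theorem coeff_eq_of_eval_eq_mul_prod [Finite ι] (hp : Function.Injective fun j : ℕ => p ^ j)
    {H Q : MvPolynomial ι F} {d D : ι →₀ ℕ} (hH : H.totalDegree ≤ d.degree)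
    {P : ι → Polynomial F} (hP : ∀ i ∈ s, (P i).natDegree ≤ e i)
    (hD : D = d + ∑ i ∈ s, Finsupp.single i (e i)) (hQ : Q.totalDegree ≤ D.degree) (c : F)
    (h : ∀ α : ι → ℕ, (∀ i, α i ≤ D i) →
      MvPolynomial.eval (fun i => p ^ α i) Q =
        c * (MvPolynomial.eval (fun i => p ^ α i) H * ∏ i ∈ s, (P i).eval (p ^ α i))) :
    Q.coeff D = c * ((∏ i ∈ s, (P i).coeff (e i)) * H.coeff d) := by
  have hdegree :
      (C c * (H * ∏ i ∈ s, Polynomial.aeval (X i) (P i))).totalDegree ≤ D.degree := by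
    refine (MvPolynomial.totalDegree_mul _ _).trans ?_
    rw [MvPolynomial.totalDegree_C, zero_add, hD, map_add]
    exact (totalDegree_mul_prod_aeval_X_le hH hP).trans (by simp)
  rw [coeff_eq_of_eval_eq_on_grid hp hQ hdegree fun α hα => by
      simp only [h α hα, map_mul, map_prod, MvPolynomial.eval_C, eval_aeval_X],
    MvPolynomial.coeff_C_mul, hD, coeff_mul_prod_aeval_X hH hP]

end Interpolation

section RootPoly

variable {F : Type*} [Field F]

/-- The monic polynomial whose roots are the powers of `p` with exponents in `S`. -/
noncomputable def rootPoly (p : F) (S : Finset ℕ) : Polynomial F :=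
  ∏ e ∈ S, (Polynomial.X - Polynomial.C (p ^ e))

theorem monic_rootPoly (p : F) (S : Finset ℕ) : (rootPoly p S).Monic :=
  Polynomial.monic_prod_of_monic _ _ fun _ _ => Polynomial.monic_X_sub_C _

theorem natDegree_rootPoly (p : F) (S : Finset ℕ) : (rootPoly p S).natDegree = #S := by
  rw [rootPoly, Polynomial.natDegree_finsetProd_X_sub_C_eq_card]

theorem coeff_card_rootPoly (p : F) (S : Finset ℕ) : (rootPoly p S).coeff #S = 1 := by
  rw [← natDegree_rootPoly p S]
  exact (monic_rootPoly p S).coeff_natDegree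

theorem eval_rootPoly (p : F) (S : Finset ℕ) (y : F) :
    (rootPoly p S).eval y = ∏ e ∈ S, (y - p ^ e) := by
  simp [rootPoly, Polynomial.eval_prod]

theorem eval_rootPoly_pow_eq_zero (p : F) {S : Finset ℕ} {e : ℕ} (he : e ∈ S) :
    (rootPoly p S).eval (p ^ e) = 0 := by
  rw [eval_rootPoly]
  exact prod_eq_zero he (sub_self _)

theorem prod_pow_sub_mul_pow (p : F) {c l : ℕ} (hl : l ≤ c + 1) (y : F) :
    ∏ t ∈ range l, (p ^ c - p ^ t * y) =
      (∏ t ∈ range l, -p ^ t) * ∏ e ∈ Ico (c + 1 - l) (c + 1), (y - p ^ e) := by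
  rw [prod_Ico_eq_prod_range, show c + 1 - (c + 1 - l) = l by omega,
    ← prod_range_reflect (fun t => y - p ^ (c + 1 - l + t)), ← prod_mul_distrib]
  refine prod_congr rfl fun t ht => ?_
  rw [mem_range] at ht
  obtain ⟨u, rfl⟩ : ∃ u, c = t + u := Nat.exists_eq_add_of_le (by omega)
  rw [show t + u + 1 - l + (l - 1 - t) = u by omega, pow_add]
  ring

/-- Both sides are, up to the same constant, the product of `y - p ^ e` over the
`l + r` consecutive exponents `e` from `c + 1 - l` on. -/
theorem prod_mul_prod_Ico_eq (p : F) {c l : ℕ} (hl : l ≤ c + 1) (r : ℕ) (y : F) :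
    (∏ t ∈ range l, (p ^ c - p ^ t * y)) * ∏ e ∈ Ico (c + 1) (c + 1 + r), (y - p ^ e) =
      (∏ e ∈ Ico (c + 1 - l) (c + 1 - l + r), (y - p ^ e)) *
        ∏ t ∈ range l, (p ^ (c + r) - p ^ t * y) := by
  rw [prod_pow_sub_mul_pow p hl, prod_pow_sub_mul_pow p (hl.trans (by omega)), mul_assoc,
    mul_left_comm (∏ e ∈ Ico (c + 1 - l) (c + 1 - l + r), (y - p ^ e)),
    prod_Ico_consecutive _ (by omega) (by omega), show c + r + 1 - l = c + 1 - l + r by omega,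
    add_right_comm c r 1, prod_Ico_consecutive _ (by omega) (by omega)]

end RootPoly

section Hyperplane

variable {ι F : Type*} [Finite ι] [Field F] {p : F}

/-- The grid has only one point `x_k = p ^ N` on the hyperplane, whose weight in Lagrange
interpolation is the inverse of `∏ l < N, (p ^ N - p ^ l)`. -/
theorem coeff_eq_of_eval_eq_on_hyperplane (hp : Function.Injective fun j : ℕ => p ^ j)
    {H Q : MvPolynomial ι F} {d D : ι →₀ ℕ} {s : Finset ι} {k : ι} (hk : k ∉ s) (hdk : d k = 0)
    (hH : H.totalDegree ≤ d.degree) {P : ι → Polynomial F} {e : ι → ℕ}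
    (hP : ∀ i ∈ s, (P i).natDegree ≤ e i) {N : ℕ}
    (hD : D = d + Finsupp.single k N + ∑ i ∈ s, Finsupp.single i (e i))
    (hQ : Q.totalDegree ≤ D.degree) (c : F)
    (hoff : ∀ α : ι → ℕ, (∀ i, α i ≤ D i) → α k ≠ N →
      MvPolynomial.eval (fun i => p ^ α i) Q = 0)
    (hon : ∀ α : ι → ℕ, (∀ i, α i ≤ D i) → α k = N →
      MvPolynomial.eval (fun i => p ^ α i) Q =
        c * (MvPolynomial.eval (fun i => p ^ α i) H * ∏ i ∈ s, (P i).eval (p ^ α i))) :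
    Q.coeff D = c / (∏ l ∈ range N, (p ^ N - p ^ l)) *
      ((∏ i ∈ s, (P i).coeff (e i)) * H.coeff d) := by
  have hroot : (rootPoly p (range N)).natDegree = N := by rw [natDegree_rootPoly, card_range]
  have hlead : (rootPoly p (range N)).coeff N = 1 := by
    simpa only [card_range] using coeff_card_rootPoly p (range N)
  have hdegree : (H * Polynomial.aeval (X k) (rootPoly p (range N))).totalDegree ≤
      (d + Finsupp.single k N).degree := by
    refine (MvPolynomial.totalDegree_mul _ _).trans ?_
    rw [map_add, Finsupp.degree_single]
    exact add_le_add hH ((totalDegree_aeval_X_le k _).trans hroot.le)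
  have hDk : D k = N := by
    have hsum : ∑ i ∈ s, Finsupp.single i (e i) k = 0 :=
      sum_eq_zero fun i hi => Finsupp.single_eq_of_ne fun h => hk (h ▸ hi)
    simp [hD, hdk, hsum]
  have hne : ∏ l ∈ range N, (p ^ N - p ^ l) ≠ 0 := prod_ne_zero_iff.mpr fun l hl =>
    sub_ne_zero.mpr fun h => (mem_range.mp hl).ne' (hp h)
  rw [coeff_eq_of_eval_eq_mul_prod hp hdegree hP hD hQ (c / ∏ l ∈ range N, (p ^ N - p ^ l)),
    coeff_mul_aeval_X hH k hroot.le, hlead, one_mul]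
  intro α hα
  rw [map_mul, eval_aeval_X]
  by_cases hαk : α k = N
  · rw [hon α hα hαk, hαk, eval_rootPoly]
    field_simp
  · rw [hoff α hα hαk, eval_rootPoly_pow_eq_zero p (mem_range.mpr (by have := hα k; omega))]
    ring

end Hyperplane

section QPoch

variable {F : Type*} [Field F] {p : F}

theorem qPoch_add (r N : ℕ) : qPoch p p (r + N) = qPoch p p r * qPoch p (p ^ (r + 1)) N := by
  simp only [qPoch, prod_range_add, ← pow_succ', ← pow_add, add_right_comm]

theorem qPoch_succ (r : ℕ) : qPoch p p (r + 1) = qPoch p p r * (1 - p ^ (r + 1)) := by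
  rw [qPoch_add]
  simp [qPoch]

theorem one_sub_pow_ne_zero (hp : Function.Injective fun j : ℕ => p ^ j) {r : ℕ} (hr : r ≠ 0) :
    1 - p ^ r ≠ 0 := by
  rw [← pow_zero p]
  exact sub_ne_zero.mpr fun h => hr (hp h.symm)

theorem qPoch_pow_ne_zero (hp : Function.Injective fun j : ℕ => p ^ j) (r N : ℕ) :
    qPoch p (p ^ (r + 1)) N ≠ 0 := by
  refine prod_ne_zero_iff.mpr fun t _ => ?_
  rw [← pow_add]
  exact one_sub_pow_ne_zero hp (by omega)

theorem qPoch_ne_zero (hp : Function.Injective fun j : ℕ => p ^ j) (N : ℕ) :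
    qPoch p p N ≠ 0 := by
  simpa using qPoch_pow_ne_zero hp 0 N

theorem prod_pow_sub_pow (N r : ℕ) :
    ∏ l ∈ range N, (p ^ (N + r) - p ^ l) =
      (∏ l ∈ range N, -p ^ l) * qPoch p (p ^ (r + 1)) N := by
  rw [qPoch, ← prod_range_reflect (fun t => 1 - p ^ (r + 1) * p ^ t), ← prod_mul_distrib]
  refine prod_congr rfl fun l hl => ?_
  rw [mem_range] at hl
  rw [← pow_add, show N + r = l + (r + 1 + (N - 1 - l)) by omega, pow_add]
  ring

theorem prod_pow_sub_pow_div (hp : Function.Injective fun j : ℕ => p ^ j) (N r : ℕ) :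
    (∏ l ∈ range N, (p ^ (N + r) - p ^ l)) / ∏ l ∈ range N, (p ^ N - p ^ l) =
      qPoch p p (N + r) / (qPoch p p N * qPoch p p r) := by
  have hdenom : ∏ l ∈ range N, (p ^ N - p ^ l) = (∏ l ∈ range N, -p ^ l) * qPoch p p N := by
    simpa using prod_pow_sub_pow (p := p) N 0
  have hpow : ∏ l ∈ range N, -p ^ l ≠ 0 := prod_ne_zero_iff.mpr fun l _ h => by
    obtain ⟨rfl, _⟩ := pow_eq_zero_iff'.mp (neg_eq_zero.mp h)
    exact absurd (hp (by simp : (0 : F) ^ 1 = 0 ^ 2)) (by decide)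
  have hN := qPoch_ne_zero hp N
  have hr := qPoch_ne_zero hp r
  rw [hdenom, prod_pow_sub_pow, add_comm N r, qPoch_add]
  field_simp

end QPoch

section CompleteSymmetric

open PowerSeries (mk)

variable {σ τ R : Type*} [CommRing R]

theorem mk_pow_mul_one_sub (r : R) :
    (mk fun k => r ^ k) * (1 - PowerSeries.C r * PowerSeries.X) = 1 := by
  have h := congrArg (PowerSeries.rescale r) (PowerSeries.mk_one_mul_one_sub_eq_one R)
  simpa [PowerSeries.rescale_X, PowerSeries.rescale_mk, Pi.mul_def] using h

theorem coeff_succ_one_sub_mul (r : R) (f : PowerSeries R) (j : ℕ) :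
    PowerSeries.coeff (j + 1) ((1 - PowerSeries.C r * PowerSeries.X) * f) =
      PowerSeries.coeff (j + 1) f - r * PowerSeries.coeff j f := by
  rw [sub_mul, one_mul, map_sub, mul_assoc, PowerSeries.coeff_C_mul, mul_comm PowerSeries.X,
    PowerSeries.coeff_succ_mul_X]

theorem coeff_prod_one_sub_mul_mk_pow (W : Finset τ) (y : τ → R) (z : R) (j : ℕ) :
    PowerSeries.coeff (#W + j)
        ((∏ w ∈ W, (1 - PowerSeries.C (y w) * PowerSeries.X)) * mk fun k => z ^ k) =
      z ^ j * ∏ w ∈ W, (z - y w) := by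
  classical
  induction W using Finset.induction_on generalizing j with
  | empty => simp
  | insert w W hw ih =>
    rw [prod_insert hw, prod_insert hw, card_insert_of_notMem hw, mul_assoc, add_right_comm,
      coeff_succ_one_sub_mul, ih, add_assoc, ih]
    ring

variable [Fintype σ]

theorem aeval_hsymm_eq_coeff_prod {S : Type*} [CommRing S] [Algebra S R] [DecidableEq σ]
    (x : σ → R) (m : ℕ) :
    MvPolynomial.aeval x (MvPolynomial.hsymm σ S m) =
      PowerSeries.coeff m (∏ i, mk fun k => x i ^ k) := by
  simp only [MvPolynomial.hsymm, map_sum, map_multiset_prod, Multiset.map_map, Function.comp_def,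
    MvPolynomial.aeval_X, PowerSeries.coeff_prod, PowerSeries.coeff_mk]
  rw [← sum_coe_sort (univ.finsuppAntidiag m)]
  refine Fintype.sum_equiv ((Sym.equivNatSum σ m).trans (Equiv.subtypeEquivRight fun P => ?_)) _ _
    fun s => ?_
  · simp [mem_finsuppAntidiag, Finsupp.sum_fintype]
  · simp only [Equiv.trans_apply, Equiv.subtypeEquivRight_apply_coe,
      Sym.coe_equivNatSum_apply_apply]
    rw [prod_multiset_map_count]
    exact prod_subset (subset_univ _) fun i _ hi => by
      have hcount : Multiset.count i s.1 = 0 :=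
        Multiset.count_eq_zero_of_notMem fun h => hi (Multiset.mem_toFinset.mpr h)
      exact (congrArg (x i ^ ·) hcount).trans (pow_zero _)

/-- The complete symmetric function `h_m(X - Y)` of the difference of the alphabets
`X = {x i}` and `Y = {y l | l ∈ S}`, i.e. the coefficient of `T ^ m` in
`∏ l ∈ S, (1 - y l * T) / ∏ i, (1 - x i * T)`. -/
noncomputable def completeDiff (x : σ → R) (S : Finset τ) (y : τ → R) (m : ℕ) : R :=
  PowerSeries.coeff m
    ((∏ l ∈ S, (1 - PowerSeries.C (y l) * PowerSeries.X)) * ∏ i, mk fun k => x i ^ k)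

theorem map_completeDiff {R' : Type*} [CommRing R'] (φ : R →+* R') (x : σ → R) (S : Finset τ)
    (y : τ → R) (m : ℕ) :
    φ (completeDiff x S y m) = completeDiff (fun i => φ (x i)) S (fun l => φ (y l)) m := by
  simp only [completeDiff, ← PowerSeries.coeff_map, map_mul, map_prod, map_sub, map_one,
    PowerSeries.map_C, PowerSeries.map_X]
  congr! with i
  ext k
  simp

theorem completeDiff_zero (x : σ → R) (S : Finset τ) (y : τ → R) : completeDiff x S y 0 = 1 := by
  simp [completeDiff]

theorem completeDiff_insert_succ [DecidableEq τ] (x : σ → R) {S : Finset τ} {z : τ} (hz : z ∉ S)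
    (y : τ → R) (m : ℕ) :
    completeDiff x (insert z S) y (m + 1) =
      completeDiff x S y (m + 1) - y z * completeDiff x S y m := by
  rw [completeDiff, prod_insert hz, mul_assoc, coeff_succ_one_sub_mul, completeDiff, completeDiff]

theorem completeDiff_eq_prod [DecidableEq τ] {x : σ → R} {y : τ → R} {S U : Finset τ} {z : τ}
    {m : ℕ} (hz : z ∉ S) (hU : U ⊆ insert z S) (hcard : #S + 1 = m + #U)
    (hx : ∏ i, (1 - PowerSeries.C (x i) * PowerSeries.X) =
      ∏ l ∈ U, (1 - PowerSeries.C (y l) * PowerSeries.X)) :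
    completeDiff x S y m = ∏ w ∈ insert z S \ U, (y z - y w) := by
  set E : Finset τ → PowerSeries R := fun V => ∏ l ∈ V, (1 - PowerSeries.C (y l) * PowerSeries.X)
    with hE
  have hgeom : (∏ i, mk fun k => x i ^ k) * E U = 1 := by
    rw [show E U = _ from hx.symm, ← prod_mul_distrib]
    exact prod_eq_one fun i _ => mk_pow_mul_one_sub (x i)
  have hsplit : E S * (1 - PowerSeries.C (y z) * PowerSeries.X) = E (insert z S \ U) * E U := by
    rw [hE, prod_sdiff hU, prod_insert hz, mul_comm]
  have hquot : E S * ∏ i, mk (fun k => x i ^ k) =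
      E (insert z S \ U) * mk fun k => y z ^ k := by
    linear_combination ((∏ i, mk fun k => x i ^ k) * mk fun k => y z ^ k) * hsplit +
      (E (insert z S \ U) * mk fun k => y z ^ k) * hgeom -
      E S * (∏ i, mk fun k => x i ^ k) * mk_pow_mul_one_sub (y z)
  have hcardW : #(insert z S \ U) = m := by
    rw [card_sdiff_of_subset hU, card_insert_of_notMem hz]
    omega
  have hcoeff := coeff_prod_one_sub_mul_mk_pow (insert z S \ U) y (y z) 0
  rw [hcardW, add_zero, pow_zero, one_mul] at hcoeff
  rw [completeDiff, ← hcoeff, hquot]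

end CompleteSymmetric

section CompleteDiffDegree

variable {σ τ ι R : Type*} [Fintype σ] [CommRing R] {x : σ → MvPolynomial ι R}

theorem isHomogeneous_completeDiff_empty (hx : ∀ i, (x i).IsHomogeneous 1)
    (y : τ → MvPolynomial ι R) (m : ℕ) : (completeDiff x ∅ y m).IsHomogeneous m := by
  classical
  rw [completeDiff, prod_empty, one_mul, PowerSeries.coeff_prod]
  refine MvPolynomial.IsHomogeneous.sum _ _ _ fun l hl => ?_
  rw [← (mem_finsuppAntidiag.mp hl).1]
  refine MvPolynomial.IsHomogeneous.prod _ _ _ fun i _ => ?_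
  simpa using (hx i).pow (l i)

theorem totalDegree_completeDiff_C_le (hx : ∀ i, (x i).IsHomogeneous 1) (S : Finset τ)
    (y : τ → R) (m : ℕ) : (completeDiff x S (fun l => C (y l)) m).totalDegree ≤ m := by
  classical
  induction S using Finset.induction_on generalizing m with
  | empty => exact (isHomogeneous_completeDiff_empty hx _ m).totalDegree_le
  | insert z S hz ih =>
    cases m with
    | zero => simp [completeDiff_zero]
    | succ m =>
      rw [completeDiff_insert_succ x hz]
      refine (MvPolynomial.totalDegree_sub _ _).trans (max_le (ih _) ?_)
      refine (MvPolynomial.totalDegree_mul _ _).trans ?_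
      rw [MvPolynomial.totalDegree_C, zero_add]
      exact (ih m).trans m.le_succ

theorem coeff_completeDiff_C_mul (hx : ∀ i, (x i).IsHomogeneous 1) (S : Finset τ) (y : τ → R)
    {H : MvPolynomial ι R} {δ : ℕ} (hH : H.totalDegree ≤ δ) {d : ι →₀ ℕ} {m : ℕ}
    (hd : d.degree = δ + m) :
    (completeDiff x S (fun l => C (y l)) m * H).coeff d =
      (completeDiff x ∅ (fun l => C (y l)) m * H).coeff d := by
  classical
  cases m with
  | zero => simp only [completeDiff_zero]
  | succ m =>
    induction S using Finset.induction_on with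
    | empty => rfl
    | insert z S hz ih =>
      have hlow : (completeDiff x S (fun l => C (y l)) m * H).coeff d = 0 := by
        refine MvPolynomial.coeff_eq_zero_of_totalDegree_lt ?_
        refine (MvPolynomial.totalDegree_mul _ _).trans_lt ?_
        change _ < d.degree
        have := totalDegree_completeDiff_C_le hx S y m
        omega
      rw [completeDiff_insert_succ x hz, sub_mul, MvPolynomial.coeff_sub, ih, mul_assoc,
        MvPolynomial.coeff_C_mul, hlow, mul_zero, sub_zero]

end CompleteDiffDegree

section LetterExponents

variable {ι : Type*} {a α : ι → ℕ} {s : Finset ι}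

/-- The exponents of the powers of `p` that the letters `x_i p ^ j`, `i ∈ s`, `j < a i`, become
at `x_i = p ^ α i`. -/
def letterExponents (a α : ι → ℕ) (s : Finset ι) : Finset ℕ :=
  s.biUnion fun i => Ico (α i) (α i + a i)

theorem card_letterExponents (h : (s : Set ι).PairwiseDisjoint fun i => Ico (α i) (α i + a i)) :
    #(letterExponents a α s) = ∑ i ∈ s, a i := by
  rw [letterExponents, card_biUnion h]
  simp

theorem prod_letterExponents {R : Type*} [CommMonoid R]
    (h : (s : Set ι).PairwiseDisjoint fun i => Ico (α i) (α i + a i)) (f : ℕ → R) :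
    ∏ l ∈ letterExponents a α s, f l = ∏ i ∈ s, ∏ t ∈ range (a i), f (α i + t) := by
  rw [letterExponents, prod_biUnion h]
  refine prod_congr rfl fun i _ => ?_
  rw [prod_Ico_eq_prod_range, Nat.add_sub_cancel_left]

theorem letterExponents_subset_range {M : ℕ} (h : ∀ i ∈ s, 0 < a i → α i + a i ≤ M) :
    letterExponents a α s ⊆ range M := by
  intro l hl
  obtain ⟨i, hi, hl⟩ := mem_biUnion.mp hl
  rw [mem_Ico] at hl
  have := h i hi (by omega)
  exact mem_range.mpr (by omega)

end LetterExponents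

section Dyson

variable {ι F : Type*} [LinearOrder ι] [Field F] {p : F} {a α : ι → ℕ} {s : Finset ι}

/-- The polynomial form of `(x_i / x_j)_n`, for `i < j`, or `(q x_i / x_j)_n`, for `j < i`, where
the denominator `x_j ^ n` is cleared. -/
noncomputable def dysonFactor (p : F) (n : ℕ) (i j : ι) : MvPolynomial ι F :=
  ∏ t ∈ range n, (X j - C (p ^ (t + if i < j then 0 else 1)) * X i)

/-- The polynomial form of the `q`-Dyson product in the variables indexed by `s`. -/
noncomputable def dysonPoly (p : F) (a : ι → ℕ) (s : Finset ι) : MvPolynomial ι F :=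
  ∏ i ∈ s, ∏ j ∈ s.erase i, dysonFactor p (a i) i j

/-- The exponent in `dysonPoly p a s` of the monomial that corresponds to the constant term of the
`q`-Dyson product. -/
noncomputable def centralDegree (a : ι → ℕ) (s : Finset ι) : ι →₀ ℕ :=
  ∑ i ∈ s, Finsupp.single i (∑ j ∈ s.erase i, a j)

theorem centralDegree_apply_of_notMem {k : ι} (hk : k ∉ s) : centralDegree a s k = 0 := by
  rw [centralDegree, Finsupp.finsetSum_apply]
  exact sum_eq_zero fun i hi => Finsupp.single_eq_of_ne fun h => hk (h ▸ hi)

theorem centralDegree_apply_add {i : ι} (hi : i ∈ s) :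
    centralDegree a s i + a i = ∑ j ∈ s, a j := by
  have happly : centralDegree a s i = ∑ j ∈ s.erase i, a j := by
    rw [centralDegree, Finsupp.finsetSum_apply, sum_eq_single_of_mem i hi fun j _ hji =>
      Finsupp.single_eq_of_ne hji.symm, Finsupp.single_eq_same]
  rw [happly, sum_erase_add _ _ hi]

theorem centralDegree_insert {k : ι} (hk : k ∉ s) :
    centralDegree a (insert k s) =
      centralDegree a s + Finsupp.single k (∑ i ∈ s, a i) + ∑ i ∈ s, Finsupp.single i (a k) := by
  have hsingle : ∀ i ∈ s, Finsupp.single i (∑ j ∈ (insert k s).erase i, a j) =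
      Finsupp.single i (∑ j ∈ s.erase i, a j) + Finsupp.single i (a k) := by
    intro i hi
    have hki : k ≠ i := fun h => hk (h ▸ hi)
    rw [erase_insert_of_ne hki, sum_insert (by simp [hk]), add_comm, Finsupp.single_add]
  rw [centralDegree, sum_insert hk, erase_insert hk, sum_congr rfl hsingle, sum_add_distrib,
    ← centralDegree]
  abel

theorem isHomogeneous_dysonFactor (p : F) (n : ℕ) (i j : ι) :
    (dysonFactor p n i j).IsHomogeneous n := by
  have h := MvPolynomial.IsHomogeneous.prod (range n)
    (fun t => (X j - C (p ^ (t + if i < j then 0 else 1)) * X i : MvPolynomial ι F)) (fun _ => 1)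
    fun t _ => (MvPolynomial.isHomogeneous_X F j).sub (MvPolynomial.isHomogeneous_C_mul_X _ i)
  simpa [dysonFactor] using h

theorem isHomogeneous_dysonPoly (p : F) (a : ι → ℕ) (s : Finset ι) :
    (dysonPoly p a s).IsHomogeneous (centralDegree a s).degree := by
  have hdegree : (centralDegree a s).degree = ∑ i ∈ s, ∑ _j ∈ s.erase i, a i := by
    simp only [centralDegree, map_sum, Finsupp.degree_single]
    exact sum_comm' fun _ _ => by simp only [mem_erase]; tauto
  rw [hdegree]
  exact MvPolynomial.IsHomogeneous.prod _ _ _ fun i _ =>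
    MvPolynomial.IsHomogeneous.prod _ _ _ fun j _ => isHomogeneous_dysonFactor p (a i) i j

theorem dysonPoly_insert (p : F) (a : ι → ℕ) {k : ι} (hk : k ∉ s) :
    dysonPoly p a (insert k s) =
      dysonPoly p a s * ∏ i ∈ s, (dysonFactor p (a i) i k * dysonFactor p (a k) k i) := by
  have hrow : ∀ i ∈ s, ∏ j ∈ (insert k s).erase i, dysonFactor p (a i) i j =
      dysonFactor p (a i) i k * ∏ j ∈ s.erase i, dysonFactor p (a i) i j := by
    intro i hi
    have hki : k ≠ i := fun h => hk (h ▸ hi)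
    rw [erase_insert_of_ne hki, prod_insert (by simp [hk])]
  rw [dysonPoly, prod_insert hk, erase_insert hk, prod_congr rfl hrow, prod_mul_distrib,
    prod_mul_distrib, ← dysonPoly]
  ring

theorem eval_dysonFactor (p : F) (n : ℕ) (i j : ι) (y : ι → F) :
    MvPolynomial.eval y (dysonFactor p n i j) =
      ∏ t ∈ range n, (y j - p ^ (t + if i < j then 0 else 1) * y i) := by
  simp [dysonFactor, map_prod]

theorem notMem_Ico_of_eval_dysonPoly_ne_zero
    (h : MvPolynomial.eval (fun i => p ^ α i) (dysonPoly p a s) ≠ 0) {i j : ι} (hi : i ∈ s)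
    (hj : j ∈ s) (hij : i ≠ j) :
    α j ∉ Ico (α i + if i < j then 0 else 1) (α i + (if i < j then 0 else 1) + a i) := by
  simp only [dysonPoly, map_prod, prod_ne_zero_iff] at h
  have hfactor := h i hi j (mem_erase.mpr ⟨hij.symm, hj⟩)
  rw [eval_dysonFactor, prod_ne_zero_iff] at hfactor
  intro hmem
  rw [mem_Ico] at hmem
  refine hfactor (α j - (α i + if i < j then 0 else 1)) (mem_range.mpr (by omega)) ?_
  rw [← pow_add, sub_eq_zero]
  congr 1
  omega

theorem pairwiseDisjoint_of_eval_dysonPoly_ne_zero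
    (h : MvPolynomial.eval (fun i => p ^ α i) (dysonPoly p a s) ≠ 0) :
    (s : Set ι).PairwiseDisjoint fun i => Ico (α i) (α i + a i) := by
  intro i hi j hj hij
  have hij' := notMem_Ico_of_eval_dysonPoly_ne_zero h hi hj hij
  have hji' := notMem_Ico_of_eval_dysonPoly_ne_zero h hj hi hij.symm
  refine disjoint_left.mpr fun l hl hl' => ?_
  rw [mem_Ico] at hl hl' hij' hji'
  rcases lt_or_gt_of_ne hij with hlt | hlt
  · rw [if_pos hlt] at hij'
    rw [if_neg hlt.not_gt] at hji'
    omega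
  · rw [if_neg hlt.not_gt] at hij'
    rw [if_pos hlt] at hji'
    omega

end Dyson

section CentralCoefficient

variable {ι F : Type*} [LinearOrder ι] [Field F] {p : F} {a α : ι → ℕ} {s : Finset ι} {k : ι}

/-- The letters would fill an initial segment containing `α k + a k`; the letter `p ^ (α k + a k)`
belongs to a variable `x_i` with `i < k`, where `dysonFactor p (a k) k i` vanishes. -/
theorem eval_dysonPoly_insert_eq_zero (hk : ∀ i ∈ s, i < k)
    (hα : ∀ i ∈ s, α i + a i ≤ ∑ j ∈ s, a j + a k) (hαk : α k < ∑ j ∈ s, a j) :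
    MvPolynomial.eval (fun i => p ^ α i) (dysonPoly p a (insert k s)) = 0 := by
  by_contra hne
  have hks : k ∉ s := fun h => (hk k h).false
  have hsub : letterExponents a α (insert k s) ⊆ range (∑ j ∈ s, a j + a k) :=
    letterExponents_subset_range fun i hi _ => by
      rcases mem_insert.mp hi with rfl | his
      · omega
      · exact hα i his
  have hfill := eq_of_subset_of_card_le hsub (by
    rw [card_letterExponents (pairwiseDisjoint_of_eval_dysonPoly_ne_zero hne), card_range,
      sum_insert hks, add_comm])
  have hmem : α k + a k ∈ letterExponents a α (insert k s) := by
    rw [hfill, mem_range]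
    omega
  obtain ⟨i, hi, hmem⟩ := mem_biUnion.mp hmem
  rw [mem_Ico] at hmem
  rcases mem_insert.mp hi with rfl | his
  · omega
  · have hik := hk i his
    have hleft := notMem_Ico_of_eval_dysonPoly_ne_zero hne hi (mem_insert_self k s) hik.ne
    have hright := notMem_Ico_of_eval_dysonPoly_ne_zero hne (mem_insert_self k s) hi hik.ne'
    rw [if_pos hik, mem_Ico] at hleft
    rw [if_neg hik.not_gt, mem_Ico] at hright
    omega

theorem eval_dysonPoly_insert (hk : ∀ i ∈ s, i < k)
    (hα : ∀ i ∈ s, α i + a i ≤ ∑ j ∈ s, a j + a k) (hαk : α k = ∑ j ∈ s, a j) :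
    MvPolynomial.eval (fun i => p ^ α i) (dysonPoly p a (insert k s)) =
      (∏ l ∈ range (∑ j ∈ s, a j), (p ^ (∑ j ∈ s, a j + a k) - p ^ l)) *
        (MvPolynomial.eval (fun i => p ^ α i) (dysonPoly p a s) *
          ∏ i ∈ s, (rootPoly p (Ico (∑ j ∈ s, a j + 1 - a i) (∑ j ∈ s, a j + 1 - a i + a k))).eval
            (p ^ α i)) := by
  set N := ∑ j ∈ s, a j
  have hcross : ∀ i ∈ s, MvPolynomial.eval (fun i => p ^ α i)
      (dysonFactor p (a i) i k * dysonFactor p (a k) k i) =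
        (rootPoly p (Ico (N + 1 - a i) (N + 1 - a i + a k))).eval (p ^ α i) *
          ∏ t ∈ range (a i), (p ^ (N + a k) - p ^ (α i + t)) := by
    intro i hi
    have hle : a i ≤ N := single_le_sum (f := a) (fun _ _ => Nat.zero_le _) hi
    have h := prod_mul_prod_Ico_eq p (show a i ≤ N + 1 by omega) (a k) (p ^ α i)
    rw [map_mul, eval_dysonFactor, eval_dysonFactor, if_pos (hk i hi), if_neg (hk i hi).not_gt,
      hαk, eval_rootPoly]
    simpa only [prod_Ico_eq_prod_range _ (N + 1), Nat.add_sub_cancel_right, ← pow_add,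
      add_zero, add_comm, add_left_comm] using h
  rw [dysonPoly_insert p a fun h => (hk k h).false, map_mul, map_prod, prod_congr rfl hcross,
    prod_mul_distrib, ← mul_assoc, mul_comm]
  by_cases hzero : MvPolynomial.eval (fun i => p ^ α i) (dysonPoly p a s) *
      ∏ i ∈ s, (rootPoly p (Ico (N + 1 - a i) (N + 1 - a i + a k))).eval (p ^ α i) = 0
  · rw [hzero, mul_zero, mul_zero]
  have hdisj := pairwiseDisjoint_of_eval_dysonPoly_ne_zero (left_ne_zero_of_mul hzero)
  have hroot := prod_ne_zero_iff.mp (right_ne_zero_of_mul hzero)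
  have hsub : letterExponents a α s ⊆ range N := letterExponents_subset_range fun i hi _ => by
    by_contra! hlt
    exact hroot i hi (eval_rootPoly_pow_eq_zero p (mem_Ico.mpr (by have := hα i hi; omega)))
  have hfill := eq_of_subset_of_card_le hsub (by rw [card_letterExponents hdisj, card_range])
  rw [← prod_letterExponents hdisj fun l => p ^ (N + a k) - p ^ l, hfill]

variable [Finite ι]

theorem coeff_dysonPoly_insert (hp : Function.Injective fun j : ℕ => p ^ j)
    (hk : ∀ i ∈ s, i < k) :
    (dysonPoly p a (insert k s)).coeff (centralDegree a (insert k s)) =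
      (∏ l ∈ range (∑ i ∈ s, a i), (p ^ (∑ i ∈ s, a i + a k) - p ^ l)) /
          (∏ l ∈ range (∑ i ∈ s, a i), (p ^ (∑ i ∈ s, a i) - p ^ l)) *
        (dysonPoly p a s).coeff (centralDegree a s) := by
  have hks : k ∉ s := fun h => (hk k h).false
  have hdegree : ∀ i, (rootPoly p
      (Ico (∑ j ∈ s, a j + 1 - a i) (∑ j ∈ s, a j + 1 - a i + a k))).natDegree = a k := by
    simp [natDegree_rootPoly]
  have hbound : ∀ {α : ι → ℕ}, (∀ i, α i ≤ centralDegree a (insert k s) i) →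
      ∀ i ∈ insert k s, α i + a i ≤ ∑ j ∈ s, a j + a k := by
    intro α hα i hi
    have h := centralDegree_apply_add (a := a) hi
    rw [sum_insert hks, add_comm (a k)] at h
    exact h ▸ add_le_add_left (hα i) _
  rw [coeff_eq_of_eval_eq_on_hyperplane hp hks (centralDegree_apply_of_notMem hks)
    (isHomogeneous_dysonPoly p a s).totalDegree_le (fun i _ => (hdegree i).le)
    (centralDegree_insert hks) (isHomogeneous_dysonPoly p a _).totalDegree_le _
    (fun α hα hαk => eval_dysonPoly_insert_eq_zero hk
      (fun i hi => hbound hα i (mem_insert_of_mem hi))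
      (lt_of_le_of_ne (by simpa using hbound hα k (mem_insert_self k s)) hαk))
    (fun α hα hαk => eval_dysonPoly_insert hk
      (fun i hi => hbound hα i (mem_insert_of_mem hi)) hαk)]
  congr 1
  rw [prod_eq_one fun i _ => ?_, one_mul]
  nth_rw 2 [← hdegree i]
  exact (monic_rootPoly p _).coeff_natDegree

/-- The `q`-Dyson theorem of Zeilberger and Bressoud. -/
theorem coeff_dysonPoly_centralDegree (hp : Function.Injective fun j : ℕ => p ^ j) (a : ι → ℕ)
    (s : Finset ι) :
    (dysonPoly p a s).coeff (centralDegree a s) =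
      qPoch p p (∑ i ∈ s, a i) / ∏ i ∈ s, qPoch p p (a i) := by
  induction s using Finset.induction_on_max with
  | empty => simp [dysonPoly, centralDegree, qPoch]
  | insert k s hk ih =>
    have hks : k ∉ s := fun h => (hk k h).false
    have hne := qPoch_ne_zero hp (∑ i ∈ s, a i)
    rw [coeff_dysonPoly_insert hp hk, ih, prod_pow_sub_pow_div hp, sum_insert hks,
      prod_insert hks, add_comm (a k)]
    field_simp

end CentralCoefficient

section Letters

variable {ι F : Type*} [Field F]

/-- The letters `x_i p ^ j`, `j < a i`, of the alphabet `x^{(a)}` as polynomials. -/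
noncomputable def letterPoly (p : F) (a : ι → ℕ) (s : Σ i, Fin (a i)) : MvPolynomial ι F :=
  X s.1 * C (p ^ (s.2 : ℕ))

theorem isHomogeneous_letterPoly (p : F) (a : ι → ℕ) (s : Σ i, Fin (a i)) :
    (letterPoly p a s).IsHomogeneous 1 :=
  (MvPolynomial.isHomogeneous_X F s.1).mul (MvPolynomial.isHomogeneous_C ι _)

variable [Fintype ι]

/-- The polynomial `h_m(x^{(a)} - Y)` where `Y` consists of the powers `p ^ l`, `l < M`; for
`M = 0` it is `h_m(x^{(a)})`. -/
noncomputable def letterDiff (p : F) (a : ι → ℕ) (M m : ℕ) : MvPolynomial ι F :=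
  completeDiff (letterPoly p a) (range M) (fun l => C (p ^ l)) m

theorem prod_one_sub_letters (p : F) {a α : ι → ℕ}
    (h : ((univ : Finset ι) : Set ι).PairwiseDisjoint fun i => Ico (α i) (α i + a i)) :
    ∏ s : Σ i, Fin (a i), (1 - PowerSeries.C (p ^ (α s.1 + s.2)) * PowerSeries.X) =
      ∏ l ∈ letterExponents a α univ, (1 - PowerSeries.C (p ^ l) * PowerSeries.X) := by
  rw [prod_letterExponents h, Fintype.prod_sigma]
  exact prod_congr rfl fun i _ => by rw [prod_range]

theorem eval_letterDiff (p : F) {a α : ι → ℕ} {M m : ℕ}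
    (h : ((univ : Finset ι) : Set ι).PairwiseDisjoint fun i => Ico (α i) (α i + a i))
    (hα : letterExponents a α univ ⊆ range (M + 1)) (hM : M + 1 = ∑ i, a i + m) :
    MvPolynomial.eval (fun i => p ^ α i) (letterDiff p a M m) =
      ∏ l ∈ range (M + 1) \ letterExponents a α univ, (p ^ M - p ^ l) := by
  rw [letterDiff, map_completeDiff]
  simp only [letterPoly, map_mul, MvPolynomial.eval_X, MvPolynomial.eval_C, ← pow_add]
  rw [range_add_one] at hα ⊢
  refine completeDiff_eq_prod notMem_range_self hα ?_ (prod_one_sub_letters p h)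
  rw [card_range, card_letterExponents h, hM, add_comm]

variable [LinearOrder ι] {p : F} {a α : ι → ℕ} {M m : ℕ} {v : ι →₀ ℕ}

theorem totalDegree_letterDiff_mul_dysonPoly_le (p : F) (a : ι → ℕ) (M m : ℕ) :
    (letterDiff p a M m * dysonPoly p a univ).totalDegree ≤
      (centralDegree a univ).degree + m := by
  rw [add_comm]
  exact (MvPolynomial.totalDegree_mul _ _).trans (add_le_add
    (totalDegree_completeDiff_C_le (isHomogeneous_letterPoly p a) _ _ m)
    (isHomogeneous_dysonPoly p a univ).totalDegree_le)

theorem coeff_letterDiff_mul_dysonPoly (p : F) (a : ι → ℕ) (M : ℕ) (hv : v.degree = m) :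
    (letterDiff p a M m * dysonPoly p a univ).coeff (centralDegree a univ + v) =
      (letterDiff p a 0 m * dysonPoly p a univ).coeff (centralDegree a univ + v) :=
  coeff_completeDiff_C_mul (isHomogeneous_letterPoly p a) _ _
    (isHomogeneous_dysonPoly p a univ).totalDegree_le (by rw [map_add, hv])

/-- The factor of `h_m(X - Y)` at the exponent `l = M`, which no letter occupies, vanishes. -/
theorem eval_letterDiff_mul_dysonPoly_eq_zero (hM : M + 1 = ∑ i, a i + m)
    (hα : ∀ i, 0 < a i → α i + a i ≤ M) :
    MvPolynomial.eval (fun i => p ^ α i) (letterDiff p a M m * dysonPoly p a univ) = 0 := by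
  rw [map_mul]
  by_cases hdyson : MvPolynomial.eval (fun i => p ^ α i) (dysonPoly p a univ) = 0
  · rw [hdyson, mul_zero]
  have hsub : letterExponents a α univ ⊆ range M := letterExponents_subset_range fun i _ => hα i
  have hmem : M ∈ range (M + 1) \ letterExponents a α univ :=
    mem_sdiff.mpr ⟨self_mem_range_succ M, fun h => notMem_range_self (hsub h)⟩
  rw [eval_letterDiff p (pairwiseDisjoint_of_eval_dysonPoly_ne_zero hdyson)
    (hsub.trans (range_mono M.le_succ)) hM, prod_eq_zero hmem (sub_self _), zero_mul]

theorem coeff_letterDiff_mul_dysonPoly_eq_zero (hp : Function.Injective fun j : ℕ => p ^ j)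
    (hm : 0 < m) (hv : v.degree = m) (hlt : ∀ i, 0 < a i → v i < m) :
    (letterDiff p a 0 m * dysonPoly p a univ).coeff (centralDegree a univ + v) = 0 := by
  have hdegree := totalDegree_letterDiff_mul_dysonPoly_le p a (∑ i, a i + m - 1) m
  rw [← hv, ← map_add, hv] at hdegree
  rw [← coeff_letterDiff_mul_dysonPoly p a (∑ i, a i + m - 1) hv,
    coeff_eq_of_eval_eq_on_grid hp (Q := 0) hdegree (by simp) fun α hα => ?_,
    MvPolynomial.coeff_zero]
  rw [map_zero, eval_letterDiff_mul_dysonPoly_eq_zero (by omega) fun i hi => ?_]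
  have hαi : α i ≤ centralDegree a univ i + v i := hα i
  have := centralDegree_apply_add (a := a) (mem_univ i)
  have := hlt i hi
  omega

end Letters

section CrossFactor

variable {ι F : Type*} [LinearOrder ι] [Field F] {a : ι → ℕ} {i k : ι} {N r : ℕ}

/-- The exponents of the roots of `crossFactor`. -/
def crossRoots (a : ι → ℕ) (k : ι) (N r : ℕ) (i : ι) : Finset ℕ :=
  if i < k then insert (N + r + 1) (Ico (N + 1 - a i) (N + 1 - a i + r))
  else Ico (N - a i) (N - a i + (r + 1))

/-- The univariate polynomial in `x_i` that remains of the two Dyson factors of the pair `i`, `k`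
on the hyperplane `x_k = p ^ N` when `a k = r + 1`, after the product of `p ^ (N + r) - p ^ t x_i`
over `t < a i` is split off. -/
noncomputable def crossFactor (p : F) (a : ι → ℕ) (k : ι) (N r : ℕ) (i : ι) : Polynomial F :=
  Polynomial.C (if i < k then 1 else p ^ a i) * rootPoly p (crossRoots a k N r i)

theorem card_crossRoots (a : ι → ℕ) (k : ι) (N r : ℕ) (i : ι) :
    #(crossRoots a k N r i) = r + 1 := by
  rw [crossRoots]
  split_ifs
  · rw [card_insert_of_notMem (by rw [mem_Ico]; omega), Nat.card_Ico, Nat.add_sub_cancel_left]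
  · rw [Nat.card_Ico, Nat.add_sub_cancel_left]

theorem natDegree_crossFactor_le (p : F) (a : ι → ℕ) (k : ι) (N r : ℕ) (i : ι) :
    (crossFactor p a k N r i).natDegree ≤ r + 1 := by
  rw [crossFactor, ← card_crossRoots a k N r i, ← natDegree_rootPoly p]
  exact Polynomial.natDegree_C_mul_le _ _

theorem coeff_crossFactor (p : F) (a : ι → ℕ) (k : ι) (N r : ℕ) (i : ι) :
    (crossFactor p a k N r i).coeff (r + 1) = if i < k then 1 else p ^ a i := by
  rw [crossFactor, Polynomial.coeff_C_mul, ← card_crossRoots a k N r i, coeff_card_rootPoly,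
    mul_one]

theorem eval_crossFactor_pow_eq_zero (p : F) (hi : a i < N) {e : ℕ} (hlt : N < e + a i)
    (hle : e + a i ≤ N + r) : (crossFactor p a k N r i).eval (p ^ e) = 0 := by
  have hroot : e ∈ crossRoots a k N r i := by
    rw [crossRoots]
    split_ifs
    · exact mem_insert_of_mem (mem_Ico.mpr (by omega))
    · exact mem_Ico.mpr (by omega)
  rw [crossFactor, Polynomial.eval_mul, eval_rootPoly_pow_eq_zero p hroot, mul_zero]

variable {p : F} {y : ι → F}

theorem eval_dysonFactor_mul_of_lt (hik : i < k) (hi : a i < N) (hy : y k = p ^ N) :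
    MvPolynomial.eval y (dysonFactor p (a i) i k * dysonFactor p (r + 1) k i) =
      (crossFactor p a k N r i).eval (y i) *
        ∏ t ∈ range (a i), (p ^ (N + r) - p ^ t * y i) := by
  have hsplit : ∏ t ∈ range (r + 1), (y i - p ^ (t + 1) * p ^ N) =
      (∏ e ∈ Ico (N + 1) (N + 1 + r), (y i - p ^ e)) * (y i - p ^ (N + r + 1)) := by
    rw [prod_Ico_eq_prod_range, Nat.add_sub_cancel_left, prod_range_succ]
    simp only [← pow_add, add_assoc, add_comm, add_left_comm]
  rw [map_mul, eval_dysonFactor, eval_dysonFactor, if_pos hik, if_neg hik.not_gt, hy, hsplit,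
    crossFactor, crossRoots, if_pos hik, if_pos hik, Polynomial.eval_mul, Polynomial.eval_C,
    one_mul, eval_rootPoly, prod_insert (by rw [mem_Ico]; omega)]
  simp only [add_zero]
  rw [← mul_assoc, prod_mul_prod_Ico_eq p (by omega)]
  ring

theorem eval_dysonFactor_mul_of_gt (hki : k < i) (hi : a i < N) (hy : y k = p ^ N) :
    MvPolynomial.eval y (dysonFactor p (a i) i k * dysonFactor p (r + 1) k i) =
      (crossFactor p a k N r i).eval (y i) *
        ∏ t ∈ range (a i), (p ^ (N + r) - p ^ t * y i) := by
  obtain ⟨c, rfl⟩ : ∃ c, N = c + 1 := ⟨N - 1, by omega⟩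
  have hscale : ∏ t ∈ range (a i), (p ^ (c + 1) - p ^ (t + 1) * y i) =
      p ^ a i * ∏ t ∈ range (a i), (p ^ c - p ^ t * y i) := by
    rw [← card_range (a i), ← prod_const, card_range, ← prod_mul_distrib]
    exact prod_congr rfl fun t _ => by ring
  have hshift : ∏ t ∈ range (r + 1), (y i - p ^ t * p ^ (c + 1)) =
      ∏ e ∈ Ico (c + 1) (c + 1 + (r + 1)), (y i - p ^ e) := by
    rw [prod_Ico_eq_prod_range, Nat.add_sub_cancel_left]
    simp only [← pow_add, add_comm, add_left_comm]
  rw [map_mul, eval_dysonFactor, eval_dysonFactor, if_pos hki, if_neg hki.not_gt, hy]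
  simp only [add_zero]
  rw [hscale, hshift, crossFactor, crossRoots, if_neg hki.not_gt, if_neg hki.not_gt,
    Polynomial.eval_mul, Polynomial.eval_C, eval_rootPoly, mul_assoc,
    prod_mul_prod_Ico_eq p (by omega), mul_assoc, add_right_comm c 1 r, add_assoc c r 1]

theorem eval_dysonFactor_mul (hik : i ≠ k) (hi : a i < N) (hy : y k = p ^ N) :
    MvPolynomial.eval y (dysonFactor p (a i) i k * dysonFactor p (r + 1) k i) =
      (crossFactor p a k N r i).eval (y i) *
        ∏ t ∈ range (a i), (p ^ (N + r) - p ^ t * y i) :=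
  hik.lt_or_gt.elim (eval_dysonFactor_mul_of_lt · hi hy) (eval_dysonFactor_mul_of_gt · hi hy)

end CrossFactor

section SingleVariable

variable {ι F : Type*} [Fintype ι] [LinearOrder ι] [Field F] {p : F} {a α : ι → ℕ} {k : ι}
  {N r : ℕ}

theorem eval_dysonPoly_univ (hr : a k = r + 1) (ha : ∀ i ∈ univ.erase k, a i < N)
    (hαk : α k = N) :
    MvPolynomial.eval (fun i => p ^ α i) (dysonPoly p a univ) =
      MvPolynomial.eval (fun i => p ^ α i) (dysonPoly p a (univ.erase k)) *
        (∏ i ∈ univ.erase k, (crossFactor p a k N r i).eval (p ^ α i)) *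
        ∏ i ∈ univ.erase k, ∏ t ∈ range (a i), (p ^ (N + r) - p ^ (α i + t)) := by
  have hcross : ∀ i ∈ univ.erase k, MvPolynomial.eval (fun i => p ^ α i)
      (dysonFactor p (a i) i k * dysonFactor p (a k) k i) =
        (crossFactor p a k N r i).eval (p ^ α i) *
          ∏ t ∈ range (a i), (p ^ (N + r) - p ^ (α i + t)) := by
    intro i hi
    rw [hr, eval_dysonFactor_mul (ne_of_mem_erase hi) (ha i hi) (by rw [hαk])]
    simp only [← pow_add, add_comm]
  conv_lhs => rw [← insert_erase (mem_univ k)]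
  rw [dysonPoly_insert p a (notMem_erase k univ), map_mul, map_prod, prod_congr rfl hcross,
    prod_mul_distrib, ← mul_assoc]

theorem range_sdiff_letterExponents_univ (hr : a k = r + 1) (hαk : α k = N) :
    range (N + r + 1) \ letterExponents a α univ =
      range N \ letterExponents a α (univ.erase k) := by
  have huniv : letterExponents a α univ =
      Ico N (N + r + 1) ∪ letterExponents a α (univ.erase k) := by
    conv_lhs => rw [← insert_erase (mem_univ k)]
    rw [letterExponents, biUnion_insert, hαk, hr, ← add_assoc, letterExponents]
  ext l
  rw [huniv, mem_sdiff, mem_sdiff, mem_union, mem_range, mem_range, mem_Ico]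
  grind

theorem eval_letterDiff_mul_dysonPoly_univ {m : ℕ} (hr : a k = r + 1)
    (hm : N + (r + 1) = ∑ i, a i + m) (ha : ∀ i ∈ univ.erase k, a i < N) (hαk : α k = N)
    (hα : ∀ i ∈ univ.erase k, α i + a i ≤ N + r) :
    MvPolynomial.eval (fun i => p ^ α i) (letterDiff p a (N + r) m * dysonPoly p a univ) =
      (∏ l ∈ range N, (p ^ (N + r) - p ^ l)) *
        (MvPolynomial.eval (fun i => p ^ α i) (dysonPoly p a (univ.erase k)) *
          ∏ i ∈ univ.erase k, (crossFactor p a k N r i).eval (p ^ α i)) := by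
  rw [map_mul, eval_dysonPoly_univ hr ha hαk, mul_left_comm, mul_comm (∏ l ∈ range N, _)]
  by_cases hzero : MvPolynomial.eval (fun i => p ^ α i) (dysonPoly p a (univ.erase k)) *
      ∏ i ∈ univ.erase k, (crossFactor p a k N r i).eval (p ^ α i) = 0
  · rw [hzero, zero_mul, zero_mul]
  have hdisj := pairwiseDisjoint_of_eval_dysonPoly_ne_zero (left_ne_zero_of_mul hzero)
  have hroot := prod_ne_zero_iff.mp (right_ne_zero_of_mul hzero)
  have hle : ∀ i ∈ univ.erase k, α i + a i ≤ N := by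
    intro i hi
    by_contra! hlt
    exact hroot i hi (eval_crossFactor_pow_eq_zero p (ha i hi) hlt (hα i hi))
  have hsub : letterExponents a α (univ.erase k) ⊆ range N :=
    letterExponents_subset_range fun i hi _ => hle i hi
  have hdisj_univ : ((univ : Finset ι) : Set ι).PairwiseDisjoint
      fun i => Ico (α i) (α i + a i) := by
    rw [← insert_erase (mem_univ k), coe_insert]
    refine hdisj.insert fun i hi _ => disjoint_left.mpr fun l hl hl' => ?_
    have := hle i hi
    rw [mem_Ico] at hl hl'
    omega
  have hsub_univ : letterExponents a α univ ⊆ range (N + r + 1) :=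
    letterExponents_subset_range fun i _ _ => by
      by_cases hi : i = k
      · subst hi
        omega
      · have := hle i (mem_erase.mpr ⟨hi, mem_univ i⟩)
        omega
  rw [eval_letterDiff p hdisj_univ hsub_univ (by omega), range_sdiff_letterExponents_univ hr hαk,
    ← prod_letterExponents hdisj fun l => p ^ (N + r) - p ^ l, prod_sdiff hsub]

theorem centralDegree_univ_add_single (a : ι → ℕ) (k : ι) (m : ℕ) :
    centralDegree a univ + Finsupp.single k m = centralDegree a (univ.erase k) +
      Finsupp.single k (∑ i ∈ univ.erase k, a i + m) +
        ∑ i ∈ univ.erase k, Finsupp.single i (a k) := by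
  have h := centralDegree_insert (a := a) (notMem_erase k univ)
  rw [insert_erase (mem_univ k)] at h
  rw [h, Finsupp.single_add]
  abel

theorem add_le_of_le_centralDegree_add_single {m : ℕ}
    (hα : ∀ i, α i ≤ (centralDegree a univ + Finsupp.single k m) i) (i : ι) :
    α i + a i ≤ ∑ j, a j + if i = k then m else 0 := by
  have hαi := hα i
  rw [Finsupp.add_apply, Finsupp.single_apply] at hαi
  simp only [eq_comm (a := k)] at hαi
  have := centralDegree_apply_add (a := a) (mem_univ i)
  omega

/-- On the grid only the hyperplane `x_k = p ^ (b + m)`, where `b = ∑ i ≠ k, a i`, contributes. -/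
theorem coeff_letterDiff_mul_dysonPoly_single (hp : Function.Injective fun j : ℕ => p ^ j)
    {m b : ℕ} (hm : 0 < m) (hr : a k = r + 1) (hb : ∑ i ∈ univ.erase k, a i = b) :
    (letterDiff p a 0 m * dysonPoly p a univ).coeff
        (centralDegree a univ + Finsupp.single k m) =
      qPoch p p (b + m + r) / (qPoch p p (b + m) * qPoch p p r) *
        ((∏ i ∈ univ.erase k, if i < k then 1 else p ^ a i) *
          (qPoch p p b / ∏ i ∈ univ.erase k, qPoch p p (a i))) := by
  have hks : k ∉ univ.erase k := notMem_erase k univ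
  have htotal : ∑ i, a i = b + (r + 1) := by
    rw [← sum_erase_add _ _ (mem_univ k), hb, hr]
  have hai : ∀ i ∈ univ.erase k, a i < b + m := fun i hi => by
    have := single_le_sum (f := a) (fun _ _ => Nat.zero_le _) hi
    omega
  have hD := centralDegree_univ_add_single a k m
  rw [hb, hr] at hD
  have hdegree := totalDegree_letterDiff_mul_dysonPoly_le p a (b + m + r) m
  rw [← Finsupp.degree_single k m, ← map_add, Finsupp.degree_single] at hdegree
  rw [← coeff_letterDiff_mul_dysonPoly p a (b + m + r) (Finsupp.degree_single k m),
    coeff_eq_of_eval_eq_on_hyperplane hp hks (centralDegree_apply_of_notMem hks)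
      (isHomogeneous_dysonPoly p a (univ.erase k)).totalDegree_le
      (fun i _ => natDegree_crossFactor_le p a k (b + m) r i) hD hdegree
      (∏ l ∈ range (b + m), (p ^ (b + m + r) - p ^ l)) (fun α hα hαk => ?_) fun α hα hαk => ?_,
    prod_pow_sub_pow_div hp, coeff_dysonPoly_centralDegree hp, hb]
  · simp only [coeff_crossFactor]
  · refine eval_letterDiff_mul_dysonPoly_eq_zero (by omega) fun i _ => ?_
    have := add_le_of_le_centralDegree_add_single hα i
    split_ifs at this with hi
    · subst hi
      omega
    · omega
  · refine eval_letterDiff_mul_dysonPoly_univ hr (by omega) hai hαk fun i hi => ?_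
    have := add_le_of_le_centralDegree_add_single hα i
    rw [if_neg (ne_of_mem_erase hi)] at this
    omega

end SingleVariable

section Laurent

theorem q_pow_injective : Function.Injective fun j : ℕ => q ^ j := by
  intro i j hij
  have h : (algebraMap (Polynomial ℚ) K) (Polynomial.X ^ i) =
      (algebraMap (Polynomial ℚ) K) (Polynomial.X ^ j) := by
    simpa only [map_pow, RatFunc.algebraMap_X, q] using hij
  simpa only [Polynomial.natDegree_X_pow] using
    congrArg Polynomial.natDegree (RatFunc.algebraMap_injective ℚ h)

variable {n : ℕ}

theorem mono_mul (u v : Fin n → ℤ) : mono u * mono v = mono (u + v) := by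
  simp only [mono, AddMonoidAlgebra.single_mul_single, mul_one]

theorem mono_prod {β : Type*} (s : Finset β) (u : β → Fin n → ℤ) :
    ∏ i ∈ s, mono (u i) = mono (∑ i ∈ s, u i) := by
  simp only [mono, AddMonoidAlgebra.prod_single, prod_const_one]

theorem mono_pow (u : Fin n → ℤ) (k : ℕ) : mono u ^ k = mono (k • u) := by
  rw [mono, AddMonoidAlgebra.single_pow, one_pow, mono]

/-- The embedding of the polynomials in `x_1, …, x_n` into the Laurent polynomials. -/
noncomputable def toLaurent (n : ℕ) : MvPolynomial (Fin n) K →ₐ[K] Laurent n :=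
  MvPolynomial.aeval x

theorem toLaurent_X (i : Fin n) : toLaurent n (X i) = x i :=
  MvPolynomial.aeval_X _ _

theorem toLaurent_C (c : K) : toLaurent n (C c) = algebraMap K (Laurent n) c :=
  MvPolynomial.aeval_C _ _

theorem toLaurent_monomial (e : Fin n →₀ ℕ) (c : K) :
    toLaurent n (MvPolynomial.monomial e c) = AddMonoidAlgebra.single (fun i => (e i : ℤ)) c := by
  have hexp : ∑ i, e i • (Pi.single i 1 : Fin n → ℤ) = fun i => (e i : ℤ) := by
    ext i
    simp [Finset.sum_apply, Pi.single_apply]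
  have h : (e.prod fun i k => (x i : Laurent n) ^ k) = mono fun i => (e i : ℤ) := by
    rw [Finsupp.prod_fintype _ _ fun i => pow_zero _, ← hexp, ← mono_prod]
    exact prod_congr rfl fun i _ => mono_pow _ _
  rw [toLaurent, MvPolynomial.aeval_monomial, h, mono, ← Algebra.smul_def,
    AddMonoidAlgebra.smul_single, smul_eq_mul, mul_one]

theorem coeff_toLaurent (P : MvPolynomial (Fin n) K) (d : Fin n →₀ ℕ) :
    (toLaurent n P).coeff (fun i => (d i : ℤ)) = P.coeff d := by
  classical
  induction P using MvPolynomial.induction_on' with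
  | monomial e c =>
    have hinj : (fun i => (e i : ℤ)) = (fun i => (d i : ℤ)) ↔ e = d := by
      simp only [funext_iff, Nat.cast_inj, Finsupp.ext_iff]
    rw [toLaurent_monomial, MvPolynomial.coeff_monomial, AddMonoidAlgebra.coeff_single,
      Finsupp.single_apply]
    simp only [hinj]
  | add P Q hP hQ =>
    rw [map_add, MvPolynomial.coeff_add, ← hP, ← hQ, AddMonoidAlgebra.coeff_add, Finsupp.add_apply]

theorem CT_mono_mul_toLaurent (d : Fin n →₀ ℕ) (P : MvPolynomial (Fin n) K) :
    CT (mono (fun i => -(d i : ℤ)) * toLaurent n P) = P.coeff d := by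
  rw [CT, mono, AddMonoidAlgebra.coeff_single_mul_apply, one_mul, add_zero, ← coeff_toLaurent]
  congr 1
  funext i
  exact neg_neg _

theorem hAlphabet_eq_toLaurent (a : Fin n → ℕ) (m : ℕ) :
    hAlphabet a m = toLaurent n (letterDiff q a 0 m) := by
  have hletter : ∀ s, toLaurent n (letterPoly q a s) = alphabet a s := fun s => by
    rw [letterPoly, map_mul, toLaurent_X, toLaurent_C, alphabet, qL, map_pow]
  rw [hAlphabet, aeval_hsymm_eq_coeff_prod, letterDiff, ← AlgHom.coe_toRingHom, map_completeDiff,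
    completeDiff, range_zero, prod_empty, one_mul]
  simp only [AlgHom.coe_toRingHom, hletter]

theorem one_sub_ratio_mul (i j : Fin n) (c : K) :
    1 - ratio i j * algebraMap K (Laurent n) c =
      mono (-Pi.single j 1) * toLaurent n (X j - C c * X i) := by
  have hone : (mono 0 : Laurent n) = 1 := rfl
  rw [map_sub, map_mul, toLaurent_X, toLaurent_X, toLaurent_C, mul_sub, x, x, mono_mul,
    neg_add_cancel, hone, mul_left_comm, mono_mul, ratio, neg_add_eq_sub, mul_comm]

theorem qPoch_ratio (N : ℕ) (i j : Fin n) :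
    qPoch (qL n) (qL n ^ (if i < j then 0 else 1) * ratio i j) N =
      mono (-Pi.single j (N : ℤ)) * toLaurent n (dysonFactor q N i j) := by
  have hmono : (mono (-Pi.single j (N : ℤ)) : Laurent n) =
      ∏ _t ∈ range N, mono (-Pi.single j 1) := by
    rw [prod_const, card_range, mono_pow, smul_neg, ← Pi.single_smul, nsmul_one]
  rw [hmono, dysonFactor, map_prod, ← prod_mul_distrib, qPoch]
  refine prod_congr rfl fun t _ => ?_
  rw [← one_sub_ratio_mul, map_pow, ← qL, pow_add]
  ring

theorem dyson_eq_prod (a : Fin n → ℕ) :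
    dyson a = ∏ i, ∏ j ∈ univ.erase i,
      qPoch (qL n) (qL n ^ (if i < j then 0 else 1) * ratio i j) (a i) := by
  simp only [← compl_singleton]
  rw [← prod_prod_Ioi_mul_eq_prod_prod_off_diag, dyson]
  refine prod_congr rfl fun i _ => prod_congr rfl fun j hj => ?_
  have hij := mem_Ioi.mp hj
  rw [if_pos hij, if_neg hij.not_gt, pow_zero, one_mul, pow_one, mul_comm]

theorem dyson_eq_mono_mul_toLaurent (a : Fin n → ℕ) :
    dyson a = mono (fun i => -(centralDegree a univ i : ℤ)) *
      toLaurent n (dysonPoly q a univ) := by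
  have hexp : ∑ i, ∑ j ∈ univ.erase i, -Pi.single j (a i : ℤ) =
      fun i => -(centralDegree a univ i : ℤ) := by
    rw [sum_comm' (t' := univ) (s' := fun j => univ.erase j) (by simp [eq_comm])]
    funext l
    simp only [Finset.sum_apply, Pi.neg_apply, Pi.single_apply, centralDegree,
      Finsupp.finsetSum_apply, Finsupp.single_apply, sum_neg_distrib]
    push_cast
    simp [eq_comm]
  rw [dyson_eq_prod, dysonPoly, map_prod, ← hexp, ← mono_prod, ← prod_mul_distrib]
  refine prod_congr rfl fun i _ => ?_
  rw [map_prod, ← mono_prod, ← prod_mul_distrib]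
  exact prod_congr rfl fun j _ => qPoch_ratio (a i) i j

theorem D_eq_coeff (v a : Fin n → ℕ) (m : ℕ) :
    D v m a = (letterDiff q a 0 m * dysonPoly q a univ).coeff
      (centralDegree a univ + Finsupp.equivFunOnFinite.symm v) := by
  have hmono : mono (fun i => -(v i : ℤ)) * mono (fun i => -(centralDegree a univ i : ℤ)) =
      mono fun i => -((centralDegree a univ + Finsupp.equivFunOnFinite.symm v) i : ℤ) := by
    rw [mono_mul]
    congr 1
    funext i
    simp
  rw [D, hAlphabet_eq_toLaurent, dyson_eq_mono_mul_toLaurent, mul_mul_mul_comm, hmono, ← map_mul,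
    CT_mono_mul_toLaurent]

end Laurent

section Evaluation

variable {n : ℕ}

theorem sortedParts_single (k : Fin n) {m : ℕ} (hm : 0 < m) :
    sortedParts (Pi.single k m : Fin n → ℕ) = [m] := by
  have hzero :
      ((univ.erase k).val.map (Pi.single k m : Fin n → ℕ)).filter (fun p => p ≠ 0) = 0 := by
    refine Multiset.filter_eq_nil.mpr fun p hp => ?_
    obtain ⟨i, hi, rfl⟩ := Multiset.mem_map.mp hp
    rw [Pi.single_eq_of_ne (ne_of_mem_erase (mem_def.mpr hi))]
    simp
  have h : ((univ : Finset (Fin n)).val.map (Pi.single k m : Fin n → ℕ)).filter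
      (fun p => p ≠ 0) = {m} := by
    rw [← insert_erase (mem_univ k), insert_val_of_notMem (notMem_erase k _), Multiset.map_cons,
      Pi.single_eq_same, Multiset.filter_cons_of_pos (p := fun p => p ≠ 0) _ hm.ne', hzero]
    rfl
  rw [sortedParts, h, Multiset.sort_singleton]

theorem eq_single_of_sum_eq_of_le {v : Fin n → ℕ} {m : ℕ} (hv : ∑ i, v i = m) {k : Fin n}
    (hk : m ≤ v k) : v = Pi.single k m := by
  rw [← add_sum_erase _ _ (mem_univ k)] at hv
  have hzero : ∑ i ∈ univ.erase k, v i = 0 := by omega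
  funext i
  by_cases hi : i = k
  · subst hi
    rw [Pi.single_eq_same]
    omega
  · rw [Pi.single_eq_of_ne hi]
    exact sum_eq_zero_iff.mp hzero i (mem_erase.mpr ⟨hi, mem_univ i⟩)

theorem D_eq_zero_of_sum_ne {v : Fin n → ℕ} {m : ℕ} (hv : ∑ i, v i ≠ m) (a : Fin n → ℕ) :
    D v m a = 0 := by
  rw [D_eq_coeff, letterDiff, range_zero]
  refine ((isHomogeneous_completeDiff_empty (isHomogeneous_letterPoly q a) _ m).mul
    (isHomogeneous_dysonPoly q a univ)).coeff_eq_zero ?_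
  rw [map_add, Finsupp.degree_eq_sum (Finsupp.equivFunOnFinite.symm v), add_comm]
  simpa using hv

theorem D_eq_zero_of_lt {v a : Fin n → ℕ} {m : ℕ} (hm : 0 < m) (hv : ∑ i, v i = m)
    (hlt : ∀ i, 0 < a i → v i < m) : D v m a = 0 := by
  rw [D_eq_coeff]
  exact coeff_letterDiff_mul_dysonPoly_eq_zero q_pow_injective hm
    (by simpa [Finsupp.degree_eq_sum] using hv) hlt

theorem D_eq_zero_of_sortedParts_ne {v : Fin n → ℕ} {m : ℕ} (hm : 0 < m)
    (hv : sortedParts v ≠ [m]) (a : Fin n → ℕ) : D v m a = 0 := by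
  by_cases hsum : ∑ i, v i = m
  · refine D_eq_zero_of_lt hm hsum fun i _ => not_le.mp fun hi => hv ?_
    rw [eq_single_of_sum_eq_of_le hsum hi, sortedParts_single i hm]
  · exact D_eq_zero_of_sum_ne hsum a

theorem prod_ite_pow_eq (p : K) (a : Fin n → ℕ) (k : Fin n) :
    (∏ i ∈ univ.erase k, if i < k then 1 else p ^ a i) = p ^ (total a - partialSum a k) := by
  have htotal : total a = partialSum a k + ∑ i ∈ Ioi k, a i := by
    rw [total, partialSum, ← sum_add_sum_compl (Iic k), show (Iic k)ᶜ = Ioi k by ext; simp]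
  rw [htotal, Nat.add_sub_cancel_left, ← prod_pow_eq_pow_sum, prod_ite, prod_const_one, one_mul]
  refine prod_congr ?_ fun _ _ => rfl
  ext i
  simp only [mem_filter, mem_erase, mem_univ, mem_Ioi]
  grind

theorem D_single_of_eq_succ (a : Fin n → ℕ) {k : Fin n} {m r : ℕ} (hm : 0 < m)
    (hr : a k = r + 1) :
    D (Pi.single k m) m a =
      q ^ (total a - partialSum a k) * (1 - q ^ a k) * qPoch q (q ^ total a) m /
        ((1 - q ^ total a) * qPoch q (q ^ (total a - a k + 1)) m) * qMultinomial a := by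
  obtain ⟨b, hb⟩ : ∃ b, ∑ i ∈ univ.erase k, a i = b := ⟨_, rfl⟩
  have htotal : total a = b + r + 1 := by
    rw [total, ← sum_erase_add _ _ (mem_univ k), hb, hr, add_assoc]
  have hprod : ∏ i ∈ univ.erase k, qPoch q q (a i) ≠ 0 :=
    prod_ne_zero_iff.mpr fun i _ => qPoch_ne_zero q_pow_injective _
  have hqb := qPoch_ne_zero q_pow_injective b
  have hqr := qPoch_ne_zero q_pow_injective r
  have hqbm := qPoch_pow_ne_zero q_pow_injective b m
  have hqtotal := one_sub_pow_ne_zero q_pow_injective (b + r).succ_ne_zero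
  have hqak := one_sub_pow_ne_zero q_pow_injective r.succ_ne_zero
  rw [D_eq_coeff, Finsupp.equivFunOnFinite_symm_single,
    coeff_letterDiff_mul_dysonPoly_single q_pow_injective hm hr hb, prod_ite_pow_eq,
    qMultinomial, ← mul_prod_erase _ _ (mem_univ k), hr]
  generalize q ^ (total a - partialSum a k) = z
  rw [htotal, show b + r + 1 - (r + 1) + 1 = b + 1 by omega, qPoch_add b m,
    add_right_comm b m r, qPoch_add (b + r) m, qPoch_succ (b + r), qPoch_succ r]
  field_simp

end Evaluation

end Kadell

theorem theorem1p3 {n : ℕ} (m : ℕ) (hm : 0 < m) (v a : Fin n → ℕ) :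
    (Kadell.sortedParts v ≠ [m] → Kadell.D v m a = 0) ∧
    (∀ k : Fin n, v = Pi.single k m →
      Kadell.D v m a =
        Kadell.q ^ (Kadell.total a - Kadell.partialSum a k) * (1 - Kadell.q ^ a k) *
            Kadell.qPoch Kadell.q (Kadell.q ^ Kadell.total a) m /
          ((1 - Kadell.q ^ Kadell.total a) *
            Kadell.qPoch Kadell.q (Kadell.q ^ (Kadell.total a - a k + 1)) m) *
          Kadell.qMultinomial a) := by
  refine ⟨fun hv => Kadell.D_eq_zero_of_sortedParts_ne hm hv a, ?_⟩
  rintro k rfl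
  rcases Nat.eq_zero_or_pos (a k) with hak | hak
  · have hlt : ∀ i, 0 < a i → (Pi.single k m : Fin n → ℕ) i < m := fun i hi => by
      rwa [Pi.single_eq_of_ne (by rintro rfl; omega)]
    rw [Kadell.D_eq_zero_of_lt hm (by simp) hlt, hak]
    simp
  · exact Kadell.D_single_of_eq_succ a hm (Nat.succ_pred_eq_of_pos hak).symm
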